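/- \textbf{Parity-controlled phase unitary.} Let $\omega>0$ and let $I=[x_-,x_+]$ be a bounded interval, $x_-<x_+$ (for instance $[0,\ell]$ or $[-\ell/2,\ell/2]$). Let $\mathfrak F$ be the bosonic Fock space over $L^2(I)$ with vacuum $|\Omega\rangle$, field operator $\psi(x)$ and particle density $n(x)=\psi^\dagger(x)\psi(x)$. Let $X,Z$ be the Pauli matrices, $|0)=(1,0)^T$, $(+|=(1,1)$. For a constant matrix $Q\in M_2(\mathbb C)$, a function $T:\mathbb R\to M_2(\mathbb C)$ and $B\in M_2(\mathbb C)$ put $V_x^y=e^{(y-x)Q}$ and $$c_N(x_1,\dots,x_N)=\mathrm{Tr}\big(B\,V_{x_-}^{x_1}T(x_1)V_{x_1}^{x_2}T(x_2)\cdots T(x_N)V_{x_N}^{x_+}\big),\qquad N\ge 0,$$ and let the diagonal continuous matrix product operator with bond dimension $2$ given by $B,Q,T$ be $$U=\sum_{N\ge0}\int_{x_-\le x_1<\dots<x_N\le x_+}c_N(x)\,\psi^\dagger(x_1)\cdots\psi^\dagger(x_N)|\Omega\rangle\langle\Omega|\psi(x_N)\cdots\psi(x_1)\,dx,$$ in the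 sense of matrix elements. For $N\ge 0$ let $$\theta_N(x_1,\dots,x_N)=-\sum_{j=1}^N(-1)^{N-j}x_j\qquad(\theta_0=0),$$ and for $c\in\mathbb R$ let $$K_c=\int_I (x-c)\,(-1)^{\Pi(x)}\,n(x)\,dx,\qquad \Pi(x)=\int_x^{x_+}n(z)\,dz,$$ where a particle located at $x$ is not counted by $\Pi(x)$ (so that $\Pi(x)$ commutes with $\psi^\dagger(x)$). Here $K_c$ is the operator on its maximal domain with these matrix elements against all vectors of finitely many particles. Below, $V_x^y$ always denotes $e^{(y-x)\frac{i\omega}{2}Z}$. \begin{enumerate} \item For the bulk-uniform tensors $B=V_{x_+}^{x_-}|0)(+|$, $Q=\frac{i\omega}{2}Z$, $T=X$ one has, for all $N\ge 0$ and all $x_1,\dots,x_N$, $$c_N(x_1,\dots,x_N)=e^{i\omega\theta_N(x_1-x_-,\dots,x_N-x_-)}.$$ $U$ is a well-defined unitary operator on $\mathfrak F$, $K_{x_-}$ is self-adjoint, and $U=e^{-i\omega K_{x_-}}$. In particular, for $I=[0,\ell]$ one has $c_N=e^{i\omega\theta_N(x_1,\dots,x_N)}$ and $U=e^{-i\omega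 K}$ with $K=\int_I x(-1)^{\Pi(x)}n(x)\,dx$. \item For each of the two choices \begin{itemize} \item $B=V_{x_+}^{0}|0)(+|V_{0}^{x_-}$, $Q=\frac{i\omega}{2}Z$, $T=X$, \item $B=|0)(+|$, $Q=0$, $T(x)=e^{\frac{i\omega x}{2}Z}Xe^{-\frac{i\omega x}{2}Z}$, \end{itemize} one has $c_N(x_1,\dots,x_N)=e^{i\omega\theta_N(x_1,\dots,x_N)}$ for all $N\ge 0$ and all $x_1,\dots,x_N$. $U$ is a well-defined unitary operator on $\mathfrak F$, $K=K_0=\int_I x(-1)^{\Pi(x)}n(x)\,dx$ is self-adjoint, and $U=e^{-i\omega K}$. This holds on every interval $I$, in particular on $I=[-\ell/2,\ell/2]$, where $\Pi(x)=\int_x^{\ell/2}n(z)\,dz$. \item For $x\in I$, multiplication of an $N$-particle wave function by the number of its coordinates $y_j>x$ has the matrix elements of $\int_x^{x_+}n(z)\,dz$ between vectors with finitely many particles, so that this multiplication operator is $\Pi(x)$. \end{enumerate} -/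

import Mathlib

open MeasureTheory Complex
open scoped InnerProductSpace Matrix

noncomputable section

namespace StringCMPU

/-! ### The bosonic Fock space over the interval `[a, b]` -/

/-- Lebesgue measure on the box `[a, b]^N`. -/
abbrev boxMeasure (a b : ℝ) (N : ℕ) : Measure (Fin N → ℝ) :=
  Measure.pi fun _ => volume.restrict (Set.Icc a b)

theorem measurePreserving_perm (a b : ℝ) {N : ℕ} (σ : Equiv.Perm (Fin N)) :
    MeasurePreserving (fun x : Fin N → ℝ => x ∘ σ) (boxMeasure a b N) (boxMeasure a b N) :=
  measurePreserving_arrowCongr' (fun _ => volume.restrict (Set.Icc a b))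
    (fun _ => volume.restrict (Set.Icc a b)) σ.symm (MeasurableEquiv.refl ℝ)
    (fun _ => MeasurePreserving.id _)

/-- The `N`-particle sector: the square-integrable functions on `[a, b]^N` that are invariant
under every permutation of the coordinates. -/
def sector (a b : ℝ) (N : ℕ) : Submodule ℂ (Lp ℂ 2 (boxMeasure a b N)) :=
  ⨅ σ : Equiv.Perm (Fin N), LinearMap.eqLocus
    (Lp.compMeasurePreservingₗ ℂ (fun x : Fin N → ℝ => x ∘ σ) (measurePreserving_perm a b σ))
    LinearMap.id

theorem isClosed_sector (a b : ℝ) (N : ℕ) :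
    IsClosed (sector a b N : Set (Lp ℂ 2 (boxMeasure a b N))) := by
  rw [sector, Submodule.coe_iInf]
  refine isClosed_iInter fun σ => ?_
  exact isClosed_eq (Lp.isometry_compMeasurePreserving (measurePreserving_perm a b σ)).continuous
    continuous_id

instance completeSpace_sector (a b : ℝ) (N : ℕ) : CompleteSpace (sector a b N) :=
  (isClosed_sector a b N).completeSpace_coe

/-- The bosonic Fock space: the Hilbert sum of the `N`-particle sectors, `N ≥ 0`. -/
abbrev Fock (a b : ℝ) : Type := lp (fun N : ℕ => sector a b N) 2

/-- Sequences of `N`-particle wave functions, `N ≥ 0`. -/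
abbrev Wave : Type := (N : ℕ) → (Fin N → ℝ) → ℂ

/-- The wave functions of a Fock space vector (with the normalization
`Φ = ∑ N, (N!)^(-1/2) ∫ Φ_N(x) ψ†(x₁) ⋯ ψ†(x_N) |Ω⟩ dx`). -/
def wave {a b : ℝ} (Φ : Fock a b) : Wave :=
  fun N => ((Φ N : Lp ℂ 2 (boxMeasure a b N)) : (Fin N → ℝ) → ℂ)

/-- Vectors with finitely many nonzero particle-number components. -/
def FiniteParticle {a b : ℝ} (Φ : Fock a b) : Prop :=
  ∃ n : ℕ, ∀ N, n ≤ N → Φ N = 0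

/-- The Fock space inner product, on wave functions. -/
def braket (a b : ℝ) (F G : Wave) : ℂ :=
  ∑' N, ∫ y, (starRingEnd ℂ) (F N y) * G N y ∂(boxMeasure a b N)

/-- The annihilation operator at a point,
`(ψ(x) F)_N (y₁, …, y_N) = √(N+1) F_{N+1} (x, y₁, …, y_N)`. -/
def annihilate (x : ℝ) (F : Wave) : Wave :=
  fun N y => (Real.sqrt (N + 1) : ℂ) * F (N + 1) (Fin.cons x y)

/-- `ψ(x_N) ⋯ ψ(x₁) F` for the list `[x₁, …, x_N]`. -/
def annihilateList : List ℝ → Wave → Wave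
  | [], F => F
  | x :: l, F => annihilateList l (annihilate x F)

/-- The amplitude `⟨Ω| ψ(x_N) ⋯ ψ(x₁) |F⟩`. -/
def amplitude {N : ℕ} (x : Fin N → ℝ) (F : Wave) : ℂ :=
  annihilateList (List.ofFn x) F 0 Fin.elim0

/-! ### Phase continuous matrix product operators with bond dimension two -/

/-- The propagator `V_x^y = exp ((y - x) Q)` of a constant matrix `Q`. -/
def propagator (Q : Matrix (Fin 2) (Fin 2) ℂ) (x y : ℝ) : Matrix (Fin 2) (Fin 2) ℂ :=
  NormedSpace.exp (((y - x : ℝ) : ℂ) • Q)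

/-- `V_p^{x₁} T(x₁) V_{x₁}^{x₂} T(x₂) ⋯ T(x_N) V_{x_N}^b` for the list `[x₁, …, x_N]`. -/
def matrixChain (Q : Matrix (Fin 2) (Fin 2) ℂ) (T : ℝ → Matrix (Fin 2) (Fin 2) ℂ) (b : ℝ) :
    ℝ → List ℝ → Matrix (Fin 2) (Fin 2) ℂ
  | p, [] => propagator Q p b
  | p, x :: l => propagator Q p x * T x * matrixChain Q T b x l

/-- The matrix product coefficient
`Tr (B V_a^{x₁} T(x₁) V_{x₁}^{x₂} ⋯ T(x_N) V_{x_N}^b)` on the interval `[a, b]`. -/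
def mpCoeff (a b : ℝ) (B Q : Matrix (Fin 2) (Fin 2) ℂ) (T : ℝ → Matrix (Fin 2) (Fin 2) ℂ)
    {N : ℕ} (x : Fin N → ℝ) : ℂ :=
  Matrix.trace (B * matrixChain Q T b a (List.ofFn x))

/-- The path-ordered integral
`∫_{a ≤ x₁ < ⋯ < x_N ≤ b} c(x) ⟨Φ|ψ†(x₁) ⋯ ψ†(x_N)|Ω⟩ ⟨Ω|ψ(x_N) ⋯ ψ(x₁)|Φ'⟩ dx` has this
integrand, `c` being the matrix product coefficient. -/
def cmpoIntegrand (a b : ℝ) (B Q : Matrix (Fin 2) (Fin 2) ℂ)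
    (T : ℝ → Matrix (Fin 2) (Fin 2) ℂ) (Φ Φ' : Fock a b) (N : ℕ) (x : Fin N → ℝ) : ℂ :=
  mpCoeff a b B Q T x *
    ((starRingEnd ℂ) (amplitude x (wave Φ)) * amplitude x (wave Φ'))

/-- The bounded operator `U` is the diagonal cMPO
`∑ N, ∫_{a ≤ x₁ < ⋯ < x_N ≤ b} Tr (B V_a^{x₁} T(x₁) ⋯ T(x_N) V_{x_N}^b)
  ψ†(x₁) ⋯ ψ†(x_N) |Ω⟩⟨Ω| ψ(x_N) ⋯ ψ(x₁) dx`,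
in the sense of matrix elements between arbitrary vectors (which determine `U`). -/
def IsDiagonalCMPO (a b : ℝ) (B Q : Matrix (Fin 2) (Fin 2) ℂ)
    (T : ℝ → Matrix (Fin 2) (Fin 2) ℂ) (U : Fock a b →L[ℂ] Fock a b) : Prop :=
  ∀ Φ Φ' : Fock a b,
    (∀ N, IntegrableOn (cmpoIntegrand a b B Q T Φ Φ' N) {x | StrictMono x} (boxMeasure a b N)) ∧
    HasSum (fun N => ∫ x in {x : Fin N → ℝ | StrictMono x},
      cmpoIntegrand a b B Q T Φ Φ' N x ∂(boxMeasure a b N)) ⟪Φ, U Φ'⟫_ℂ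

/-- The Pauli matrix `X`. -/
def pauliX : Matrix (Fin 2) (Fin 2) ℂ := !![0, 1; 1, 0]

/-- The Pauli matrix `Z`. -/
def pauliZ : Matrix (Fin 2) (Fin 2) ℂ := !![1, 0; 0, -1]

/-- The bond space operator `|0)(+|` with `|0) = (1, 0)` and `(+| = (1, 1)`. -/
def ketZeroBraPlus : Matrix (Fin 2) (Fin 2) ℂ := Matrix.vecMulVec ![1, 0] ![1, 1]

/-- `Q = (i ω / 2) Z`. -/
def bondQ (ω : ℝ) : Matrix (Fin 2) (Fin 2) ℂ := (I * (ω / 2 : ℂ)) • pauliZ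

/-- `θ_N (x₁, …, x_N) = - ∑ j, (-1)^(N - j) x_j` (so `θ_0 = 0`); the index `j : Fin N` starts
at zero. -/
def phaseFunction {N : ℕ} (x : Fin N → ℝ) : ℝ :=
  -∑ j : Fin N, (-1 : ℝ) ^ (N - (j.val + 1)) * x j

/-! ### The string operator -/

/-- The string `Π(x) = ∫_x^b n(z) dz`, which multiplies an `N`-particle wave function at
`(y₁, …, y_N)` by the number of particles to the right of `x`; a particle at `x` itself does not
count, which is the convention `[Π(x), ψ†(x)] = 0`. -/
def rightCount (x : ℝ) {N : ℕ} (y : Fin N → ℝ) : ℕ :=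
  (Finset.univ.filter fun j => x < y j).card

/-- `Π(x)` on wave functions. -/
def stringNumber (x : ℝ) (F : Wave) : Wave := fun _ y => (rightCount x y : ℂ) * F _ y

/-- `(-1)^Π(x)` on wave functions. -/
def stringParity (x : ℝ) (F : Wave) : Wave := fun _ y => (-1 : ℂ) ^ rightCount x y * F _ y

/-- The matrix element `⟨F| ∫_{[a,b]} (x - c) (-1)^Π(x) ψ†(x) ψ(x) dx |G⟩`, the factor
`(-1)^Π(x) ψ†(x)` acting to the left as its adjoint `ψ(x) (-1)^Π(x)`. -/
def stringForm (a b c : ℝ) (F G : Wave) : ℂ :=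
  ∫ x in Set.Icc a b,
    ((x - c : ℝ) : ℂ) * braket a b (annihilate x (stringParity x F)) (annihilate x G)

/-- `K` is the operator `∫_{[a,b]} (x - c) (-1)^Π(x) n(x) dx` on its maximal domain: `K Φ = Ξ` if
and only if `Ξ` has the matrix elements of the integral with every vector of finitely many
particles. As these vectors are dense, there is at most one such `K`. -/
def IsStringOperator (a b c : ℝ) (K : Fock a b →ₗ.[ℂ] Fock a b) : Prop :=
  ∀ Φ Ξ : Fock a b, (Φ, Ξ) ∈ K.graph ↔
    ∀ Φ₀ : Fock a b, FiniteParticle Φ₀ → ⟪Φ₀, Ξ⟫_ℂ = stringForm a b c (wave Φ₀) (wave Φ)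

/-- `W t = exp (-i t K)` for all real `t`: `W` is the strongly continuous one-parameter unitary
group with infinitesimal generator `-i K`. -/
structure IsUnitaryGroupOf {H : Type*} [NormedAddCommGroup H] [InnerProductSpace ℂ H]
    [CompleteSpace H] (K : H →ₗ.[ℂ] H) (W : ℝ → H →L[ℂ] H) : Prop where
  unitary : ∀ t, W t ∈ unitary (H →L[ℂ] H)
  map_zero : W 0 = 1
  map_add : ∀ s t, W (s + t) = W s * W t
  continuous : ∀ Φ, Continuous fun t => W t Φ
  generator : ∀ Φ Ξ, (Φ, Ξ) ∈ K.graph ↔ HasDerivAt (fun t => W t Φ) (-(I • Ξ)) 0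

/-- `U = exp (-i ω K)`. -/
def IsExp {H : Type*} [NormedAddCommGroup H] [InnerProductSpace ℂ H] [CompleteSpace H]
    (K : H →ₗ.[ℂ] H) (ω : ℝ) (U : H →L[ℂ] H) : Prop :=
  ∃ W : ℝ → H →L[ℂ] H, IsUnitaryGroupOf K W ∧ U = W ω

/-- The tensors `B`, `Q`, `T` define on `[a, b]` a unitary operator `U`, the string operator
`K = ∫_{[a,b]} (x - c) (-1)^Π(x) n(x) dx` exists and is self-adjoint, and
`U = exp (-i ω K)`. -/
def IsStringExponential (a b c ω : ℝ) (B Q : Matrix (Fin 2) (Fin 2) ℂ)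
    (T : ℝ → Matrix (Fin 2) (Fin 2) ℂ) : Prop :=
  ∃ (U : Fock a b →L[ℂ] Fock a b) (K : Fock a b →ₗ.[ℂ] Fock a b),
    IsDiagonalCMPO a b B Q T U ∧ U ∈ unitary (Fock a b →L[ℂ] Fock a b) ∧
    IsStringOperator a b c K ∧ IsSelfAdjoint K ∧ IsExp K ω U

end StringCMPU

end

open StringCMPU

noncomputable section

namespace StringCMPU

open Filter Topology

/-! ### Diagonal operators on Hilbert sums -/

section Diagonal

variable {ι : Type*} {G : ι → Type*} [∀ i, NormedAddCommGroup (G i)]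

/-! Everything is diagonal in particle positions. On the `N`-particle sector `K_c` multiplies by the
symmetric function `k = stringPhase c`. On ordered configurations the string sign of the `j`-th
particle is `(-1)^(N-j)`, so there `k = -θ_N(x - c)`, and `U = exp(-iωK_c)` reduces to identifying
the matrix product coefficient with `exp(iωθ_N(x - c))`.

The coefficient is found by passing to the interaction picture around `c`
(`matrixChain_mul_propagator`): each `X` becomes an antidiagonal matrix with entries `exp(±iω(x_j -
c))`. The product has one nonzero entry in its first column, carrying the alternating phase, and
`(+|` reads it off for either parity of `N`.

The analysis rests on `k` being bounded on each box, though not uniformly in `N`. Sectorwise the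
exponential is norm-differentiable (`hasDerivAt_mulOp_phase`); `isUnitaryGroupOf_lpDiagonal` and
`isSelfAdjoint_lpDiagonal` assemble the sectors on the maximal domain. Two symmetrization identities
connect this with second quantization: `integral_eq_factorial_mul_strictMono` for the path-ordered
integrals, and `IsWeight.integral_tsum` for one-body integrals. -/

theorem memlp_two_iff {f : ∀ i, G i} : Memℓp f 2 ↔ Summable fun i => ‖f i‖ ^ 2 := by
  rw [memℓp_gen_iff (by norm_num)]
  norm_num

theorem lp_norm_sq_eq_tsum (f : lp G 2) : ‖f‖ ^ 2 = ∑' i, ‖f i‖ ^ 2 := by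
  have := lp.norm_rpow_eq_tsum (p := 2) (by norm_num) f
  norm_num at this
  exact this

theorem lp_summable_norm_sq (f : lp G 2) : Summable fun i => ‖f i‖ ^ 2 :=
  memlp_two_iff.1 (lp.memℓp f)

/-- Dominated convergence in a Hilbert sum. -/
theorem tendsto_lp_of_dominated {α : Type*} {l : Filter α} {F : α → lp G 2} {f : lp G 2}
    {bound : ι → ℝ} (hb : Summable fun i => bound i ^ 2)
    (h : ∀ᶠ a in l, ∀ i, ‖F a i - f i‖ ≤ bound i)
    (hlim : ∀ i, Tendsto (fun a => F a i) l (𝓝 (f i))) : Tendsto F l (𝓝 f) := by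
  rw [tendsto_iff_norm_sub_tendsto_zero]
  have key : Tendsto (fun a => ∑' i, ‖(F a - f) i‖ ^ 2) l (𝓝 (∑' _ : ι, (0 : ℝ))) := by
    refine tendsto_tsum_of_dominated_convergence hb (fun i => ?_) ?_
    · have := ((tendsto_iff_norm_sub_tendsto_zero.1 (hlim i)).pow 2)
      simpa using this
    · filter_upwards [h] with a ha i
      rw [Real.norm_of_nonneg (by positivity)]
      exact pow_le_pow_left₀ (norm_nonneg _) (ha i) 2
  have h2 := key.sqrt
  simp only [← lp_norm_sq_eq_tsum, tsum_zero, Real.sqrt_zero] at h2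
  simpa [Real.sqrt_sq (norm_nonneg _)] using h2

variable [∀ i, InnerProductSpace ℂ (G i)]

/-- The direct sum of a family of contractions. -/
def lpContraction (T : ∀ i, G i →L[ℂ] G i) (hT : ∀ i x, ‖T i x‖ ≤ ‖x‖) : lp G 2 →L[ℂ] lp G 2 :=
  have hmem : ∀ f : lp G 2, Memℓp (fun i => T i (f i)) 2 := fun f =>
    memlp_two_iff.2 ((lp_summable_norm_sq f).of_nonneg_of_le (fun _ => by positivity)
      fun i => pow_le_pow_left₀ (norm_nonneg _) (hT i (f i)) 2)
  LinearMap.mkContinuous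
    { toFun := fun f => (⟨fun i => T i (f i), hmem f⟩ : lp G 2)
      map_add' := fun f g => by ext i; simp; rfl
      map_smul' := fun c f => by ext i; simp } 1 fun f => by
    rw [one_mul]
    refine lp.norm_mono (by norm_num) fun i => ?_
    exact hT i (f i)

@[simp]
theorem lpContraction_apply (T : ∀ i, G i →L[ℂ] G i) (hT : ∀ i x, ‖T i x‖ ≤ ‖x‖) (f : lp G 2)
    (i : ι) : lpContraction T hT f i = T i (f i) := rfl

/-- The direct sum of a family of bounded operators, on its maximal domain. -/
def lpDiagonal (A : ∀ i, G i →L[ℂ] G i) : lp G 2 →ₗ.[ℂ] lp G 2 where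
  domain :=
    { carrier := {f | Memℓp (fun i => A i (f i)) 2}
      add_mem' := fun {f g} hf hg => by
        have := Memℓp.add hf hg
        simpa [Pi.add_def] using this
      zero_mem' := by simpa [Pi.zero_def] using (zero_memℓp : Memℓp (0 : ∀ i, G i) 2)
      smul_mem' := fun c f hf => by
        have := Memℓp.const_smul hf c
        simpa [Pi.smul_def] using this }
  toFun :=
    { toFun := fun f => (⟨fun i => A i ((f : lp G 2) i), f.2⟩ : lp G 2)
      map_add' := fun f g => by ext i; simp; rfl
      map_smul' := fun c f => by ext i; simp }

/-- The domain is maximal, so a square-summable `g` with the right coordinates already places `f` in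
it; no separate domain condition remains. -/
theorem mem_graph_lpDiagonal {A : ∀ i, G i →L[ℂ] G i} {f g : lp G 2} :
    (f, g) ∈ (lpDiagonal A).graph ↔ ∀ i, g i = A i (f i) := by
  rw [LinearPMap.mem_graph_iff]
  constructor
  · rintro ⟨y, rfl, rfl⟩ i
    rfl
  · intro h
    have hf : f ∈ (lpDiagonal A).domain := by
      change Memℓp (fun i => A i (f i)) 2
      simp_rw [← h]
      exact lp.memℓp g
    exact ⟨⟨f, hf⟩, rfl, by ext i; exact (h i).symm⟩

theorem single_mem_graph_lpDiagonal [DecidableEq ι] (A : ∀ i, G i →L[ℂ] G i) (i : ι) (x : G i) :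
    (lp.single 2 i x, lp.single 2 i (A i x)) ∈ (lpDiagonal A).graph := by
  refine mem_graph_lpDiagonal.2 fun j => ?_
  rcases eq_or_ne j i with rfl | h
  · simp
  · rw [lp.single_apply_ne _ _ _ h, lp.single_apply_ne _ _ _ h, _root_.map_zero]

theorem dense_domain_lpDiagonal (A : ∀ i, G i →L[ℂ] G i) :
    Dense ((lpDiagonal A).domain : Set (lp G 2)) := by
  classical
  intro f
  refine mem_closure_of_tendsto (lp.hasSum_single (by norm_num) f)
    (Eventually.of_forall fun s => ?_)
  exact Submodule.sum_mem _ fun i _ =>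
    LinearPMap.mem_domain_of_mem_graph (single_mem_graph_lpDiagonal A i (f i))

/-- Testing the adjoint relation on vectors supported in one summand determines `g` coordinate by
coordinate, so the adjoint cannot extend beyond the maximal domain. -/
theorem isSelfAdjoint_lpDiagonal [∀ i, CompleteSpace (G i)] {A : ∀ i, G i →L[ℂ] G i}
    (hA : ∀ i x y, ⟪A i x, y⟫_ℂ = ⟪x, A i y⟫_ℂ) : IsSelfAdjoint (lpDiagonal A) := by
  classical
  rw [LinearPMap.isSelfAdjoint_def]
  apply LinearPMap.eq_of_eq_graph
  rw [LinearPMap.adjoint_graph_eq_graph_adjoint (dense_domain_lpDiagonal A)]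
  ext ⟨f, g⟩
  rw [Submodule.mem_adjoint_iff, mem_graph_lpDiagonal]
  constructor
  · intro h i
    refine ext_inner_left ℂ fun v => ?_
    have := h _ _ (single_mem_graph_lpDiagonal A i v)
    simp only [lp.inner_single_left] at this
    rw [← hA, ← sub_eq_zero.1 this]
  · intro h u v huv
    rw [mem_graph_lpDiagonal] at huv
    simp only [lp.inner_eq_tsum, huv, h, hA, sub_self]

/-- A direct sum of unitary groups with bounded generators is a unitary group, and its generator is
the direct sum of the generators on the maximal domain. -/
theorem isUnitaryGroupOf_lpDiagonal [∀ i, CompleteSpace (G i)] {A : ∀ i, G i →L[ℂ] G i}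
    {W : ∀ i, ℝ → G i →L[ℂ] G i} (hW : ∀ t i x, ‖W i t x‖ ≤ ‖x‖)
    (hzero : ∀ i, W i 0 = 1) (hadd : ∀ i s t, W i (s + t) = W i s * W i t)
    (hadj : ∀ i t x y, ⟪W i t x, y⟫_ℂ = ⟪x, W i (-t) y⟫_ℂ)
    (hder : ∀ i x, HasDerivAt (fun t => W i t x) (-(I • A i x)) 0) :
    IsUnitaryGroupOf (lpDiagonal A) fun t => lpContraction (fun i => W i t) (hW t) := by
  have hz : lpContraction (fun i => W i 0) (hW 0) = 1 := by
    ext f i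
    simp [hzero]
  have ha : ∀ s t, lpContraction (fun i => W i (s + t)) (hW (s + t)) =
      lpContraction (fun i => W i s) (hW s) * lpContraction (fun i => W i t) (hW t) := by
    intro s t
    ext f i
    simp [hadd]
  have hstar : ∀ t, star (lpContraction (fun i => W i t) (hW t)) =
      lpContraction (fun i => W i (-t)) (hW (-t)) := by
    intro t
    rw [ContinuousLinearMap.star_eq_adjoint, eq_comm, ContinuousLinearMap.eq_adjoint_iff]
    intro f g
    simp [lp.inner_eq_tsum, hadj]
  -- The group law transports the derivative at `0` to every `s`.
  have hder' : ∀ i x s, HasDerivAt (fun t => W i t x) (W i s (-(I • A i x))) s := by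
    intro i x s
    have h1 : HasDerivAt (fun t => W i (t - s) x) (-(I • A i x)) s := by
      have := hder i x
      rw [← sub_self s] at this
      exact this.comp_sub_const s s
    have h2 := ((W i s).restrictScalars ℝ).hasFDerivAt.comp_hasDerivAt s h1
    refine h2.congr_of_eventuallyEq (Eventually.of_forall fun t => ?_)
    change W i t x = (W i s * W i (t - s)) x
    rw [← hadd, add_sub_cancel]
  -- Mean value inequality: this bounds the difference quotients by `‖A i x‖` uniformly in `t`,
  -- which is the domination needed to differentiate the whole sum.
  have hlip : ∀ i x t, ‖W i t x - x‖ ≤ ‖A i x‖ * |t| := by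
    intro i x t
    have := convex_univ.norm_image_sub_le_of_norm_hasDerivWithin_le (C := ‖A i x‖)
      (f := fun t => W i t x) (x := (0 : ℝ)) (y := t)
      (fun s _ => (hder' i x s).hasDerivWithinAt)
      (fun s _ => (hW s i _).trans (by simp [norm_smul])) (Set.mem_univ _) (Set.mem_univ _)
    simpa [hzero] using this
  refine ⟨fun t => ?_, hz, ha, fun f => ?_, fun f g => ?_⟩
  · rw [Unitary.mem_iff, hstar, ← ha, ← ha]
    simp only [neg_add_cancel, add_neg_cancel]
    exact ⟨hz, hz⟩
  · refine continuous_iff_continuousAt.2 fun s => ?_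
    refine tendsto_lp_of_dominated (bound := fun i => 2 * ‖f i‖) ?_
      (Eventually.of_forall fun t i => ?_) fun i => ?_
    · simp_rw [mul_pow]
      exact (lp_summable_norm_sq f).mul_left _
    · rw [two_mul]
      exact (norm_sub_le _ _).trans (add_le_add (hW t i _) (hW s i _))
    · exact (hder' i (f i) s).continuousAt
  · rw [mem_graph_lpDiagonal]
    constructor
    · intro h
      have hs : ∀ t i, slope (fun t => lpContraction (fun i => W i t) (hW t) f) 0 t i =
          slope (fun t => W i t (f i)) 0 t := fun t i => rfl
      have hg : ∀ i, (-(I • g) : lp G 2) i = -(I • A i (f i)) := fun i => by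
        rw [← h i]
        rfl
      refine hasDerivAt_iff_tendsto_slope.2 ?_
      refine tendsto_lp_of_dominated (bound := fun i => 2 * ‖g i‖) ?_ ?_ fun i => ?_
      · simp_rw [mul_pow]
        exact (lp_summable_norm_sq g).mul_left _
      · filter_upwards [self_mem_nhdsWithin] with t ht i
        have ht : t ≠ 0 := ht
        rw [hs, hg]
        have h1 : ‖t⁻¹ • (W i t (f i) - f i)‖ ≤ ‖g i‖ := by
          rw [norm_smul, norm_inv, Real.norm_eq_abs, inv_mul_le_iff₀ (by positivity), h i, mul_comm]
          exact hlip i (f i) t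
        rw [two_mul]
        refine (norm_sub_le _ _).trans (add_le_add ?_ (by simp [norm_smul, h i]))
        simpa [slope, hzero] using h1
      · simp_rw [hs, hg]
        exact hasDerivAt_iff_tendsto_slope.1 (hder i (f i))
    -- Conversely, evaluation at `i` is continuous, so differentiability of the sum gives each
    -- coordinate derivative, which is unique.
    · intro h i
      have h1 := ((lp.evalCLM ℂ G 2 i).restrictScalars ℝ).hasFDerivAt.comp_hasDerivAt 0 h
      have h2 : HasDerivAt (fun t => W i t (f i)) (-(I • g i)) 0 := h1
      have h3 := h2.unique (hder i (f i))
      exact smul_right_injective _ I_ne_zero (neg_injective h3)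

end Diagonal

/-! ### Multiplication operators on the sectors -/

section Sectors

variable {a b : ℝ} {N : ℕ}

theorem mem_sector_iff {g : Lp ℂ 2 (boxMeasure a b N)} :
    g ∈ sector a b N ↔
      ∀ σ : Equiv.Perm (Fin N), ∀ᵐ y ∂boxMeasure a b N, g (y ∘ σ) = g y := by
  rw [sector, Submodule.mem_iInf]
  refine forall_congr' fun σ => ?_
  rw [LinearMap.mem_eqLocus]
  change Lp.compMeasurePreserving _ (measurePreserving_perm a b σ) g = g ↔ _
  have h := Lp.coeFn_compMeasurePreserving g (measurePreserving_perm a b σ)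
  rw [Lp.ext_iff]
  exact ⟨fun h1 => h.symm.trans h1, fun h1 => h.trans h1⟩

theorem wave_perm (Φ : Fock a b) (N : ℕ) (σ : Equiv.Perm (Fin N)) :
    ∀ᵐ y ∂boxMeasure a b N, wave Φ N (y ∘ σ) = wave Φ N y :=
  mem_sector_iff.1 (Φ N).2 σ

/-- Measurable, essentially bounded and symmetric functions on the box. -/
structure IsMultiplier (a b : ℝ) {N : ℕ} (f : (Fin N → ℝ) → ℂ) : Prop where
  measurable : Measurable f
  bounded : ∃ C, ∀ᵐ y ∂boxMeasure a b N, ‖f y‖ ≤ C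
  symm : ∀ (σ : Equiv.Perm (Fin N)) (y : Fin N → ℝ), f (y ∘ σ) = f y

theorem memLp_mul {f : (Fin N → ℝ) → ℂ} (hf : IsMultiplier a b f)
    (g : Lp ℂ 2 (boxMeasure a b N)) : MemLp (fun y => f y * g y) 2 (boxMeasure a b N) := by
  obtain ⟨C, hC⟩ := hf.bounded
  exact (Lp.memLp g).of_le_mul (c := C)
    (hf.measurable.aestronglyMeasurable.mul (Lp.aestronglyMeasurable g))
    (hC.mono fun y hy => by
      rw [norm_mul]
      exact mul_le_mul_of_nonneg_right hy (norm_nonneg _))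

theorem toLp_mul_mem_sector {f : (Fin N → ℝ) → ℂ} (hf : IsMultiplier a b f) (g : sector a b N) :
    (memLp_mul hf (g : Lp ℂ 2 (boxMeasure a b N))).toLp ∈ sector a b N := by
  refine mem_sector_iff.2 fun σ => ?_
  have h := (memLp_mul hf (g : Lp ℂ 2 (boxMeasure a b N))).coeFn_toLp
  filter_upwards [h, (measurePreserving_perm a b σ).quasiMeasurePreserving.ae h,
    mem_sector_iff.1 g.2 σ] with y h1 h2 h3
  rw [h1, h2, hf.symm, h3]

/-- Multiplication by `f` on the `N`-particle sector. -/
def mulOp (f : (Fin N → ℝ) → ℂ) (hf : IsMultiplier a b f) : sector a b N →L[ℂ] sector a b N :=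
  LinearMap.mkContinuousOfExistsBound
    { toFun := fun g => ⟨_, toLp_mul_mem_sector hf g⟩
      map_add' := fun g g' => by
        ext1
        apply Lp.ext
        refine (memLp_mul hf (↑(g + g') : Lp ℂ 2 (boxMeasure a b N))).coeFn_toLp.trans ?_
        refine EventuallyEq.trans ?_ (Lp.coeFn_add _ _).symm
        filter_upwards [Lp.coeFn_add (g : Lp ℂ 2 (boxMeasure a b N)) g',
          (memLp_mul hf (g : Lp ℂ 2 (boxMeasure a b N))).coeFn_toLp,
          (memLp_mul hf (g' : Lp ℂ 2 (boxMeasure a b N))).coeFn_toLp] with y h1 h2 h3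
        simp only [Submodule.coe_add, Pi.add_apply] at h1 ⊢
        rw [h1, h2, h3, mul_add]
      map_smul' := fun c g => by
        ext1
        apply Lp.ext
        refine (memLp_mul hf (↑(c • g) : Lp ℂ 2 (boxMeasure a b N))).coeFn_toLp.trans ?_
        refine EventuallyEq.trans ?_ (Lp.coeFn_smul _ _).symm
        filter_upwards [Lp.coeFn_smul c (g : Lp ℂ 2 (boxMeasure a b N)),
          (memLp_mul hf (g : Lp ℂ 2 (boxMeasure a b N))).coeFn_toLp] with y h1 h2
        simp only [Submodule.coe_smul, Pi.smul_apply, smul_eq_mul, RingHom.id_apply] at h1 ⊢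
        rw [h1, h2, mul_left_comm] }
    (by
      obtain ⟨C, hC⟩ := hf.bounded
      refine ⟨C, fun g => Lp.norm_le_mul_norm_of_ae_le_mul ?_⟩
      filter_upwards [hC, (memLp_mul hf (g : Lp ℂ 2 (boxMeasure a b N))).coeFn_toLp] with y h1 h2
      refine (congrArg norm h2).trans_le ?_
      rw [norm_mul]
      exact mul_le_mul_of_nonneg_right h1 (norm_nonneg _))

theorem coeFn_mulOp {f : (Fin N → ℝ) → ℂ} (hf : IsMultiplier a b f) (g : sector a b N) :
    ((mulOp f hf g : Lp ℂ 2 (boxMeasure a b N)) : (Fin N → ℝ) → ℂ)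
      =ᵐ[boxMeasure a b N] fun y => f y * (g : Lp ℂ 2 (boxMeasure a b N)) y :=
  (memLp_mul hf (g : Lp ℂ 2 (boxMeasure a b N))).coeFn_toLp

theorem sector_ext {g g' : sector a b N}
    (h : ∀ᵐ y ∂boxMeasure a b N, (g : Lp ℂ 2 (boxMeasure a b N)) y =
      (g' : Lp ℂ 2 (boxMeasure a b N)) y) : g = g' :=
  Subtype.ext (Lp.ext h)

theorem sector_norm_le {g g' : sector a b N} {C : ℝ}
    (h : ∀ᵐ y ∂boxMeasure a b N, ‖(g : Lp ℂ 2 (boxMeasure a b N)) y‖ ≤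
      C * ‖(g' : Lp ℂ 2 (boxMeasure a b N)) y‖) : ‖g‖ ≤ C * ‖g'‖ :=
  Lp.norm_le_mul_norm_of_ae_le_mul h

theorem norm_mulOp_le {f : (Fin N → ℝ) → ℂ} (hf : IsMultiplier a b f) {C : ℝ}
    (hC : ∀ᵐ y ∂boxMeasure a b N, ‖f y‖ ≤ C) (g : sector a b N) : ‖mulOp f hf g‖ ≤ C * ‖g‖ := by
  refine sector_norm_le ?_
  filter_upwards [hC, coeFn_mulOp hf g] with y h1 h2
  rw [h2, norm_mul]
  exact mul_le_mul_of_nonneg_right h1 (norm_nonneg _)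

theorem mulOp_eq_one {f : (Fin N → ℝ) → ℂ} (hf : IsMultiplier a b f) (h : ∀ y, f y = 1) :
    mulOp f hf = 1 := by
  ext1 g
  refine sector_ext ?_
  filter_upwards [coeFn_mulOp hf g] with y h1
  rw [h1, h, one_mul]
  rfl

theorem mulOp_mul {f f' f'' : (Fin N → ℝ) → ℂ} (hf : IsMultiplier a b f)
    (hf' : IsMultiplier a b f') (hf'' : IsMultiplier a b f'') (h : ∀ y, f y = f' y * f'' y) :
    mulOp f hf = mulOp f' hf' * mulOp f'' hf'' := by
  ext1 g
  refine sector_ext ?_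
  filter_upwards [coeFn_mulOp hf g, coeFn_mulOp hf' (mulOp f'' hf'' g), coeFn_mulOp hf'' g]
    with y h1 h2 h3
  refine h1.trans (Eq.trans ?_ h2.symm)
  simp only [h3, h, mul_assoc]

theorem inner_mulOp {f : (Fin N → ℝ) → ℂ} (hf : IsMultiplier a b f) (g g' : sector a b N) :
    ⟪g, mulOp f hf g'⟫_ℂ = ∫ y, f y * ((starRingEnd ℂ) ((g : Lp ℂ 2 (boxMeasure a b N)) y) *
      (g' : Lp ℂ 2 (boxMeasure a b N)) y) ∂boxMeasure a b N := by
  rw [Submodule.coe_inner, L2.inner_def]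
  refine integral_congr_ae ?_
  filter_upwards [coeFn_mulOp hf g'] with y h1
  rw [h1, RCLike.inner_apply]
  ring

theorem inner_mulOp_left {f f' : (Fin N → ℝ) → ℂ} (hf : IsMultiplier a b f)
    (hf' : IsMultiplier a b f') (h : ∀ y, (starRingEnd ℂ) (f y) = f' y) (g g' : sector a b N) :
    ⟪mulOp f hf g, g'⟫_ℂ = ⟪g, mulOp f' hf' g'⟫_ℂ := by
  rw [inner_mulOp, Submodule.coe_inner, L2.inner_def]
  refine integral_congr_ae ?_
  filter_upwards [coeFn_mulOp hf g] with y h1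
  rw [h1, RCLike.inner_apply, map_mul, h]
  ring

theorem integrable_conj_mul (g g' : sector a b N) :
    Integrable (fun y => (starRingEnd ℂ) ((g : Lp ℂ 2 (boxMeasure a b N)) y) *
      (g' : Lp ℂ 2 (boxMeasure a b N)) y) (boxMeasure a b N) := by
  have := L2.integrable_inner (𝕜 := ℂ) (g : Lp ℂ 2 (boxMeasure a b N)) g'
  simpa only [RCLike.inner_apply, mul_comm] using this

/-! ### Phase multipliers -/

theorem IsMultiplier.phase {k : (Fin N → ℝ) → ℝ} (hk : IsMultiplier a b fun y => (k y : ℂ))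
    (t : ℝ) : IsMultiplier a b fun y => Complex.exp (-(I * ((t * k y : ℝ) : ℂ))) where
  measurable := by
    have h : Measurable k := Complex.measurable_re.comp hk.measurable
    fun_prop
  bounded := ⟨1, Eventually.of_forall fun y => by
    rw [← mul_neg, ← Complex.ofReal_neg, mul_comm, Complex.norm_exp_ofReal_mul_I]⟩
  symm σ y := by
    have := hk.symm σ y
    rw [Complex.ofReal_inj] at this
    rw [this]

/-- With `|k| ≤ C` almost everywhere, `|exp(-itk) - 1 + itk| ≤ (C|t|)^2` once `C|t| ≤ 1`; the
remainder is thus quadratic in norm. -/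
theorem hasDerivAt_mulOp_phase {k : (Fin N → ℝ) → ℝ} (hk : IsMultiplier a b fun y => (k y : ℂ))
    (g : sector a b N) : HasDerivAt (fun t : ℝ => mulOp _ (hk.phase t) g)
      (-(I • mulOp _ hk g)) 0 := by
  obtain ⟨C₀, hC₀⟩ := hk.bounded
  -- The maximum with `1` makes `C` positive, so the radius `C⁻¹` is available.
  set C := max C₀ 1
  have hC : ∀ᵐ y ∂boxMeasure a b N, ‖(k y : ℂ)‖ ≤ C := hC₀.mono fun y h => h.trans (le_max_left _ _)
  have hC1 : 0 < C := lt_max_of_lt_right one_pos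
  rw [hasDerivAt_iff_isLittleO]
  refine Asymptotics.IsBigO.trans_isLittleO (g := fun t : ℝ => t ^ 2) ?_ ?_
  · refine Asymptotics.IsBigO.of_bound (C ^ 2 * ‖g‖) ?_
    have hball : Metric.ball (0 : ℝ) C⁻¹ ∈ 𝓝 0 := Metric.ball_mem_nhds _ (by positivity)
    filter_upwards [hball] with t ht
    rw [mem_ball_zero_iff, Real.norm_eq_abs] at ht
    have hmain : ‖mulOp _ (hk.phase t) g - g - t • (-(I • mulOp _ hk g))‖ ≤
        (C * |t|) ^ 2 * ‖g‖ := by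
      refine sector_norm_le ?_
      have e : mulOp _ (hk.phase t) g - g - t • (-(I • mulOp _ hk g)) =
          mulOp _ (hk.phase t) g - g - (-(t * I) : ℂ) • mulOp _ hk g := by
        rw [neg_smul, mul_smul, smul_neg t]
        rfl
      rw [e]
      filter_upwards [hC, coeFn_mulOp (hk.phase t) g, coeFn_mulOp hk g,
        Lp.coeFn_sub (↑(mulOp _ (hk.phase t) g - g) : Lp ℂ 2 (boxMeasure a b N))
          ((-(t * I) : ℂ) • ↑(mulOp _ hk g)),
        Lp.coeFn_sub (mulOp _ (hk.phase t) g : Lp ℂ 2 (boxMeasure a b N)) g,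
        Lp.coeFn_smul (-(t * I) : ℂ) (mulOp _ hk g : Lp ℂ 2 (boxMeasure a b N))]
        with y h1 h2 h3 h4 h5 h6
      have h7 : ‖-(I * ((t * k y : ℝ) : ℂ))‖ ≤ C * |t| := by
        rw [norm_neg, norm_mul, norm_I, one_mul, Complex.ofReal_mul, norm_mul, mul_comm,
          Complex.norm_real t, Real.norm_eq_abs]
        exact mul_le_mul_of_nonneg_right h1 (abs_nonneg t)
      have h8 : C * |t| ≤ 1 := by
        rw [← mul_inv_cancel₀ hC1.ne']
        exact mul_le_mul_of_nonneg_left ht.le hC1.le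
      have h9 := (Complex.norm_exp_sub_one_sub_id_le (h7.trans h8)).trans
        (pow_le_pow_left₀ (norm_nonneg _) h7 2)
      have h10 : (↑(mulOp _ (hk.phase t) g - g - (-(t * I) : ℂ) • mulOp _ hk g) :
          Lp ℂ 2 (boxMeasure a b N)) y =
          (Complex.exp (-(I * ((t * k y : ℝ) : ℂ))) - 1 - -(I * ((t * k y : ℝ) : ℂ))) *
            (g : Lp ℂ 2 (boxMeasure a b N)) y := by
        refine h4.trans ?_
        simp only [Submodule.coe_sub, Pi.sub_apply, Pi.smul_apply, smul_eq_mul] at h5 h6 ⊢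
        rw [h5, h6, h2, h3]
        push_cast
        ring
      rw [h10, norm_mul]
      exact mul_le_mul_of_nonneg_right h9 (norm_nonneg _)
    have hz : mulOp _ (hk.phase 0) g = g := by
      rw [mulOp_eq_one _ fun y => by simp]
      rfl
    rw [hz, sub_zero]
    refine hmain.trans_eq ?_
    rw [norm_pow, Real.norm_eq_abs]
    ring
  · simp only [sub_zero]
    exact Asymptotics.isLittleO_pow_id (by norm_num)

/-! ### The string phase -/

theorem rightCount_perm (z : ℝ) (y : Fin N → ℝ) (σ : Equiv.Perm (Fin N)) :
    rightCount z (y ∘ σ) = rightCount z y :=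
  Finset.card_equiv σ fun j => by simp

theorem measurable_rightCount :
    Measurable fun p : ℝ × (Fin N → ℝ) => rightCount p.1 p.2 := by
  simp only [rightCount, Finset.card_filter]
  refine Finset.measurable_sum _ fun i _ => ?_
  exact Measurable.ite (measurableSet_lt measurable_fst
    ((measurable_pi_apply i).comp measurable_snd)) measurable_const measurable_const

theorem measurable_apply_prodMk (j : Fin N) :
    Measurable fun y : Fin N → ℝ => (y j, y) :=
  (measurable_pi_apply j).prodMk measurable_id

/-- The factor `(z - c) (-1)^Π(z)`. -/
def stringWeight (c z : ℝ) (y : Fin N → ℝ) : ℝ := (z - c) * (-1) ^ rightCount z y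

/-- The eigenvalue `∑ j, (y_j - c) (-1)^Π(y_j)` of the string operator. -/
def stringPhase (c : ℝ) (y : Fin N → ℝ) : ℝ := ∑ j, stringWeight c (y j) y

theorem stringWeight_perm (c z : ℝ) (y : Fin N → ℝ) (σ : Equiv.Perm (Fin N)) :
    stringWeight c z (y ∘ σ) = stringWeight c z y := by
  rw [stringWeight, rightCount_perm, stringWeight]

theorem measurable_stringWeight (c : ℝ) :
    Measurable fun p : ℝ × (Fin N → ℝ) => stringWeight c p.1 p.2 :=
  (measurable_fst.sub_const c).mul
    ((measurable_from_nat (f := fun n : ℕ => (-1 : ℝ) ^ n)).comp measurable_rightCount)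

theorem ae_mem_Icc : ∀ᵐ y ∂boxMeasure a b N, ∀ j, y j ∈ Set.Icc a b :=
  ae_all_iff.2 fun j => (Measure.quasiMeasurePreserving_eval
    (fun _ : Fin N => volume.restrict (Set.Icc a b)) j).ae (ae_restrict_mem measurableSet_Icc)

theorem abs_stringWeight_le {c z : ℝ} (hz : z ∈ Set.Icc a b) (y : Fin N → ℝ) :
    |stringWeight c z y| ≤ |a - c| + |b - c| := by
  rw [stringWeight, abs_mul, abs_pow, abs_neg, abs_one, one_pow, mul_one]
  refine abs_le.2 ⟨?_, ?_⟩
  · linarith [hz.1, neg_abs_le (a - c), abs_nonneg (b - c)]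
  · linarith [hz.2, le_abs_self (b - c), abs_nonneg (a - c)]

theorem isMultiplier_stringPhase (a b c : ℝ) (N : ℕ) :
    IsMultiplier a b fun y : Fin N → ℝ => (stringPhase c y : ℂ) where
  measurable := by
    have h : ∀ j, Measurable fun y : Fin N → ℝ => stringWeight c (y j) y := fun j =>
      (measurable_stringWeight c).comp (measurable_apply_prodMk j)
    exact Complex.measurable_ofReal.comp (Finset.measurable_sum _ fun j _ => h j)
  bounded := by
    refine ⟨∑ _ : Fin N, (|a - c| + |b - c|), ?_⟩
    filter_upwards [ae_mem_Icc] with y hy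
    rw [Complex.norm_real, Real.norm_eq_abs]
    exact (Finset.abs_sum_le_sum_abs _ _).trans
      (Finset.sum_le_sum fun j _ => abs_stringWeight_le (hy j) y)
  symm σ y := by
    simp only [stringPhase, stringWeight_perm, Function.comp_apply]
    rw [Equiv.sum_comp σ fun j => stringWeight c (y j) y]

/-- In an increasing configuration the particles to the right of `x j` are those of larger index,
and there are `N - (j + 1)` of them with zero-based `j`. -/
theorem stringPhase_of_strictMono (c : ℝ) {x : Fin N → ℝ} (hx : StrictMono x) :
    stringPhase c x = -phaseFunction fun j => x j - c := by
  rw [phaseFunction, neg_neg]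
  refine Finset.sum_congr rfl fun j _ => ?_
  have h : rightCount (x j) x = N - (j.val + 1) := by
    simp only [rightCount, hx.lt_iff_lt]
    rw [Finset.filter_lt_eq_Ioi, Fin.card_Ioi]
    omega
  rw [stringWeight, h, mul_comm]

/-! ### Ordered configurations -/

/-- Each annihilation contributes the square root of the current particle number; together they give
the square root of the factorial. -/
theorem annihilateList_zero (l : List ℝ) (F : Wave) :
    annihilateList l F 0 Fin.elim0 =
      (Real.sqrt (l.length.factorial) : ℂ) * F l.length l.get := by
  induction l generalizing F with
  | nil =>
    simp only [annihilateList, List.length_nil, Nat.factorial_zero, Nat.cast_one, Real.sqrt_one,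
      Complex.ofReal_one, one_mul]
    congr 1
    exact Subsingleton.elim _ _
  | cons x l ih =>
    rw [annihilateList, ih, annihilate, ← mul_assoc, ← Complex.ofReal_mul,
      ← Real.sqrt_mul (by positivity)]
    have h1 : (l.length.factorial : ℝ) * (l.length + 1) = ((l.length + 1).factorial : ℝ) := by
      rw [Nat.factorial_succ]
      push_cast
      ring
    have h2 : (Fin.cons x l.get : Fin (l.length + 1) → ℝ) = (x :: l).get := by
      ext i
      refine Fin.cases ?_ (fun i => ?_) i <;> rfl
    rw [h1, h2]
    rfl

theorem amplitude_eq (x : Fin N → ℝ) (F : Wave) :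
    amplitude x F = (Real.sqrt N.factorial : ℂ) * F N x := by
  rw [amplitude, annihilateList_zero]
  -- The length of `List.ofFn x` equals `N` only propositionally, so the claim is generalized to `M
  -- = N` before substituting.
  have key : ∀ (M : ℕ) (g : Fin M → ℝ) (h : M = N), (∀ i : Fin M, g i = x (i.cast h)) →
      (Real.sqrt M.factorial : ℂ) * F M g = (Real.sqrt N.factorial : ℂ) * F N x := by
    rintro M g rfl hg
    rw [show g = x from funext hg]
  exact key _ _ (List.length_ofFn) fun i => by simp; rfl

theorem measurableSet_strictMono : MeasurableSet {x : Fin N → ℝ | StrictMono x} := by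
  simp only [StrictMono, Set.ofPred_forall]
  exact MeasurableSet.iInter fun i => MeasurableSet.iInter fun j => MeasurableSet.iInter fun _ =>
    measurableSet_lt (measurable_pi_apply i) (measurable_pi_apply j)

/-- Each coincidence set `y i = y j` with `i ≠ j` lies in a proper linear subspace, hence is
Lebesgue-null. -/
theorem ae_injective : ∀ᵐ y ∂boxMeasure a b N, Function.Injective y := by
  have hac : boxMeasure a b N ≪ (volume : Measure (Fin N → ℝ)) := by
    rw [boxMeasure, ← Measure.restrict_pi_pi]
    exact Measure.absolutelyContinuous_of_le Measure.restrict_le_self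
  refine hac ?_
  have : ∀ i j : Fin N, ∀ᵐ y : Fin N → ℝ, y i = y j → i = j := by
    intro i j
    rcases eq_or_ne i j with h | h
    · exact Eventually.of_forall fun _ _ => h
    · let S : Submodule ℝ (Fin N → ℝ) :=
        LinearMap.ker (LinearMap.proj (R := ℝ) (φ := fun _ => ℝ) i - LinearMap.proj j)
      have hS : S ≠ ⊤ := by
        intro hS
        have : Pi.single i (1 : ℝ) ∈ S := hS ▸ Submodule.mem_top
        simp [S, LinearMap.mem_ker, Pi.single_eq_of_ne' h] at this
      refine measure_mono_null (fun y hy => ?_) (Measure.addHaar_submodule volume S hS)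
      have hy' : y i = y j := by
        by_contra hne
        exact hy fun h => (hne h).elim
      simp [S, LinearMap.mem_ker, hy']
  filter_upwards [ae_all_iff.2 fun i => ae_all_iff.2 (this i)] with y hy i j
  exact hy i j

/-- The integral of a symmetric function over the box is `N!` times the integral over the ordered
configurations. -/
theorem integral_eq_factorial_mul_strictMono {f : (Fin N → ℝ) → ℂ}
    (hf : Integrable f (boxMeasure a b N))
    (hsymm : ∀ σ : Equiv.Perm (Fin N), ∀ᵐ y ∂boxMeasure a b N, f (y ∘ σ) = f y) :
    ∫ y, f y ∂boxMeasure a b N =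
      N.factorial * ∫ y in {x | StrictMono x}, f y ∂boxMeasure a b N := by
  set S : Set (Fin N → ℝ) := {x | StrictMono x}
  have hS : MeasurableSet S := measurableSet_strictMono
  have hperm : ∀ σ : Equiv.Perm (Fin N), MeasurableSet ((fun y : Fin N → ℝ => y ∘ σ) ⁻¹' S) :=
    fun σ => (measurePreserving_perm a b σ).measurable hS
  -- Symmetry of `f` and of the measure gives all `N!` permuted chambers the same integral.
  have h1 : ∀ σ : Equiv.Perm (Fin N),
      ∫ y, ((fun y : Fin N → ℝ => y ∘ σ) ⁻¹' S).indicator f y ∂boxMeasure a b N =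
        ∫ y in S, f y ∂boxMeasure a b N := by
    intro σ
    have hmp := measurePreserving_perm a b σ
    rw [← integral_indicator hS]
    have h2 := integral_map (f := S.indicator f) hmp.measurable.aemeasurable
      (by rw [hmp.map_eq]; exact hf.aestronglyMeasurable.indicator hS)
    rw [hmp.map_eq] at h2
    rw [h2]
    refine integral_congr_ae ?_
    filter_upwards [hsymm σ] with y hy
    by_cases h : y ∘ σ ∈ S
    · rw [Set.indicator_of_mem h, Set.indicator_of_mem (show y ∈ (fun y : Fin N → ℝ => y ∘ σ) ⁻¹' S from h), hy]
    · rw [Set.indicator_of_notMem h, Set.indicator_of_notMem (show y ∉ (fun y : Fin N → ℝ => y ∘ σ) ⁻¹' S from h)]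
  -- An injective configuration is sorted by exactly one permutation, so almost everywhere the
  -- chamber indicators sum to `f`.
  have h3 : ∫ y, f y ∂boxMeasure a b N = ∫ y, ∑ σ : Equiv.Perm (Fin N),
      ((fun y : Fin N → ℝ => y ∘ σ) ⁻¹' S).indicator f y ∂boxMeasure a b N := by
    refine integral_congr_ae ?_
    filter_upwards [ae_injective] with y hy
    have hsort : StrictMono (y ∘ Tuple.sort y) :=
      (Tuple.monotone_sort y).strictMono_of_injective (hy.comp (Tuple.sort y).injective)
    rw [Finset.sum_eq_single (Tuple.sort y) (fun σ _ hσ => ?_) fun h => (h (Finset.mem_univ _)).elim]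
    · rw [Set.indicator_of_mem]
      exact hsort
    · refine Set.indicator_of_notMem (fun hmem => hσ ?_) _
      have hmem : StrictMono (y ∘ σ) := hmem
      have := Tuple.unique_monotone hmem.monotone hsort.monotone
      ext1 i
      exact hy (congrFun this i)
  rw [h3, integral_finsetSum _ fun σ _ => hf.indicator (hperm σ)]
  simp only [h1, Finset.sum_const, Finset.card_univ, Fintype.card_perm, Fintype.card_fin,
    nsmul_eq_mul]

/-- `conj Φ_N · Φ'_N`. -/
def waveDensity (Φ Φ' : Fock a b) (N : ℕ) (y : Fin N → ℝ) : ℂ :=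
  (starRingEnd ℂ) (wave Φ N y) * wave Φ' N y

theorem integrable_waveDensity (Φ Φ' : Fock a b) (N : ℕ) :
    Integrable (waveDensity Φ Φ' N) (boxMeasure a b N) :=
  integrable_conj_mul (Φ N) (Φ' N)

theorem waveDensity_perm (Φ Φ' : Fock a b) (N : ℕ) (σ : Equiv.Perm (Fin N)) :
    ∀ᵐ y ∂boxMeasure a b N, waveDensity Φ Φ' N (y ∘ σ) = waveDensity Φ Φ' N y := by
  filter_upwards [wave_perm Φ N σ, wave_perm Φ' N σ] with y h1 h2
  rw [waveDensity, h1, h2, waveDensity]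

theorem waveDensity_ae_zero {Φ : Fock a b} {N : ℕ} (h : Φ N = 0) (Φ' : Fock a b) :
    ∀ᵐ y ∂boxMeasure a b N, waveDensity Φ Φ' N y = 0 := by
  have h1 : (Φ N : Lp ℂ 2 (boxMeasure a b N)) = 0 := by rw [h]; rfl
  filter_upwards [Lp.coeFn_zero ℂ 2 (boxMeasure a b N)] with y hy
  have h2 : wave Φ N y = 0 := by
    rw [wave, h1]
    exact hy
  rw [waveDensity, h2, map_zero, zero_mul]

theorem inner_mulOp_eq {f : (Fin N → ℝ) → ℂ} (hf : IsMultiplier a b f) (Φ Φ' : Fock a b) :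
    ⟪Φ N, mulOp f hf (Φ' N)⟫_ℂ = ∫ y, f y * waveDensity Φ Φ' N y ∂boxMeasure a b N :=
  inner_mulOp hf _ _

theorem IsMultiplier.integrable_mul {f : (Fin N → ℝ) → ℂ} (hf : IsMultiplier a b f)
    (Φ Φ' : Fock a b) : Integrable (fun y => f y * waveDensity Φ Φ' N y) (boxMeasure a b N) := by
  obtain ⟨C, hC⟩ := hf.bounded
  exact (integrable_waveDensity Φ Φ' N).bdd_mul hf.measurable.aestronglyMeasurable hC

/-- A diagonal continuous matrix product operator is the multiplication by its coefficient. -/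
theorem isDiagonalCMPO_of_phase {B Q : Matrix (Fin 2) (Fin 2) ℂ}
    {T : ℝ → Matrix (Fin 2) (Fin 2) ℂ} {U : Fock a b →L[ℂ] Fock a b}
    {f : ∀ N, (Fin N → ℝ) → ℂ} (hf : ∀ N, IsMultiplier a b (f N))
    (hU : ∀ Φ N, U Φ N = mulOp (f N) (hf N) (Φ N))
    (hc : ∀ N (x : Fin N → ℝ), StrictMono x → mpCoeff a b B Q T x = f N x) :
    IsDiagonalCMPO a b B Q T U := by
  intro Φ Φ'
  -- The two amplitudes each supply `√N!`; their product is the multiplicity produced by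
  -- symmetrization.
  have hpt : ∀ N (x : Fin N → ℝ), StrictMono x → cmpoIntegrand a b B Q T Φ Φ' N x =
      N.factorial * (f N x * waveDensity Φ Φ' N x) := by
    intro N x hx
    have hs : (Real.sqrt N.factorial : ℂ) * (Real.sqrt N.factorial : ℂ) = N.factorial := by
      rw [← Complex.ofReal_mul, Real.mul_self_sqrt (by positivity), Complex.ofReal_natCast]
    rw [cmpoIntegrand, amplitude_eq, amplitude_eq, hc N x hx, waveDensity, ← hs, map_mul,
      Complex.conj_ofReal]
    ring
  refine ⟨fun N => ?_, ?_⟩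
  · exact ((((hf N).integrable_mul Φ Φ').const_mul _).integrableOn).congr_fun
      (fun x hx => (hpt N x hx).symm) measurableSet_strictMono
  · refine (lp.hasSum_inner Φ (U Φ')).congr_fun fun N => ?_
    rw [hU, inner_mulOp_eq, integral_eq_factorial_mul_strictMono ((hf N).integrable_mul Φ Φ'),
      ← integral_const_mul]
    · exact setIntegral_congr_fun measurableSet_strictMono fun x hx => hpt N x hx
    · intro σ
      filter_upwards [waveDensity_perm Φ Φ' N σ] with y hy
      rw [(hf N).symm, hy]

/-! ### One-body integrals -/

theorem measurePreserving_cons (a b : ℝ) (N : ℕ) :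
    MeasurePreserving (fun p : ℝ × (Fin N → ℝ) => (Fin.cons p.1 p.2 : Fin (N + 1) → ℝ))
      ((volume.restrict (Set.Icc a b)).prod (boxMeasure a b N)) (boxMeasure a b (N + 1)) := by
  have := (measurePreserving_piFinSuccAbove
    (fun _ : Fin (N + 1) => volume.restrict (Set.Icc a b)) 0).symm
  convert! this using 1
  ext p : 1
  exact (Fin.insertNth_zero' _ _).symm

theorem Integrable.comp_cons {H : (Fin (N + 1) → ℝ) → ℂ}
    (hH : Integrable H (boxMeasure a b (N + 1))) :
    Integrable (fun p : ℝ × (Fin N → ℝ) => H (Fin.cons p.1 p.2))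
      ((volume.restrict (Set.Icc a b)).prod (boxMeasure a b N)) :=
  (measurePreserving_cons a b N).integrable_comp_of_integrable hH

theorem integral_integral_cons {H : (Fin (N + 1) → ℝ) → ℂ}
    (hH : Integrable H (boxMeasure a b (N + 1))) :
    ∫ x in Set.Icc a b, ∫ y, H (Fin.cons x y) ∂boxMeasure a b N =
      ∫ y, H y ∂boxMeasure a b (N + 1) := by
  have hmp := measurePreserving_cons a b N
  rw [integral_integral (Integrable.comp_cons hH), ← hmp.map_eq,
    integral_map hmp.measurable.aemeasurable (by rw [hmp.map_eq]; exact hH.aestronglyMeasurable)]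

/-- A weight which depends on a position and, symmetrically, on a configuration. -/
structure IsWeight (a b : ℝ) (w : (N : ℕ) → ℝ → (Fin N → ℝ) → ℂ) : Prop where
  measurable : ∀ N, Measurable fun p : ℝ × (Fin N → ℝ) => w N p.1 p.2
  bounded : ∃ C, ∀ N, ∀ z ∈ Set.Icc a b, ∀ y, ‖w N z y‖ ≤ C
  symm : ∀ N z (y : Fin N → ℝ) (σ : Equiv.Perm (Fin N)), w N z (y ∘ σ) = w N z y

theorem IsWeight.integrable {w : (N : ℕ) → ℝ → (Fin N → ℝ) → ℂ} (hw : IsWeight a b w)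
    (Φ Φ' : Fock a b) (j : Fin N) :
    Integrable (fun y => w N (y j) y * waveDensity Φ Φ' N y) (boxMeasure a b N) := by
  obtain ⟨C, hC⟩ := hw.bounded
  refine (integrable_waveDensity Φ Φ' N).bdd_mul (c := C) ?_ ?_
  · exact ((hw.measurable N).comp (measurable_apply_prodMk j)).aestronglyMeasurable
  · filter_upwards [ae_mem_Icc] with y hy
    exact hC N _ (hy j) y

/-- Exchanging coordinates `0` and `j` preserves the measure, the weight and, almost everywhere, the
density, so all `N + 1` summands have equal integrals. -/
theorem IsWeight.integral_sum {w : (N : ℕ) → ℝ → (Fin N → ℝ) → ℂ} (hw : IsWeight a b w)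
    (Φ Φ' : Fock a b) (N : ℕ) :
    ∫ y, (∑ j, w (N + 1) (y j) y) * waveDensity Φ Φ' (N + 1) y ∂boxMeasure a b (N + 1) =
      (N + 1) * ∫ y, w (N + 1) (y 0) y * waveDensity Φ Φ' (N + 1) y ∂boxMeasure a b (N + 1) := by
  have h : ∀ j : Fin (N + 1),
      ∫ y, w (N + 1) (y j) y * waveDensity Φ Φ' (N + 1) y ∂boxMeasure a b (N + 1) =
      ∫ y, w (N + 1) (y 0) y * waveDensity Φ Φ' (N + 1) y ∂boxMeasure a b (N + 1) := by
    intro j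
    have hmp := measurePreserving_perm a b (Equiv.swap 0 j)
    have h2 := integral_map (f := fun y => w (N + 1) (y 0) y * waveDensity Φ Φ' (N + 1) y)
      hmp.measurable.aemeasurable
      (by rw [hmp.map_eq]; exact (hw.integrable Φ Φ' 0).aestronglyMeasurable)
    rw [hmp.map_eq] at h2
    rw [h2]
    refine integral_congr_ae ?_
    filter_upwards [waveDensity_perm Φ Φ' (N + 1) (Equiv.swap 0 j)] with y hy
    rw [hy, hw.symm, Function.comp_apply, Equiv.swap_apply_left]
  simp_rw [Finset.sum_mul]
  rw [integral_finsetSum _ fun j _ => hw.integrable Φ Φ' j]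
  simp [h]

/-- Integrals over the position of one particle, for vectors with finitely many particles. -/
theorem IsWeight.integral_tsum {w : (N : ℕ) → ℝ → (Fin N → ℝ) → ℂ} (hw : IsWeight a b w)
    {Φ : Fock a b} (hΦ : FiniteParticle Φ) (Φ' : Fock a b) :
    ∫ x in Set.Icc a b, ∑' N : ℕ, ∫ y, ((N + 1 : ℂ) * (w (N + 1) x (Fin.cons x y) *
        waveDensity Φ Φ' (N + 1) (Fin.cons x y))) ∂boxMeasure a b N =
      ∑' N, ∫ y, (∑ j, w N (y j) y) * waveDensity Φ Φ' N y ∂boxMeasure a b N := by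
  obtain ⟨n, hn⟩ := hΦ
  have hint : ∀ N : ℕ, Integrable (fun y => (N + 1 : ℂ) *
      (w (N + 1) (y 0) y * waveDensity Φ Φ' (N + 1) y)) (boxMeasure a b (N + 1)) :=
    fun N => (hw.integrable Φ Φ' 0).const_mul _
  have hzero : ∀ N, n ≤ N → ∫ y, (∑ j, w N (y j) y) * waveDensity Φ Φ' N y ∂boxMeasure a b N = 0 := by
    intro N hN
    rw [integral_eq_zero_of_ae]
    filter_upwards [waveDensity_ae_zero (hn N hN) Φ'] with y hy
    rw [hy, mul_zero]
    rfl
  -- The range is `n + 1` so that splitting off the vacuum term, an empty sum over particles, leaves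
  -- `n` terms indexed by the number of remaining particles.
  rw [tsum_eq_sum (s := Finset.range (n + 1)) fun N hN => hzero N (by simp at hN; omega),
    Finset.sum_range_succ']
  have h0 : ∫ y, (∑ j, w 0 (y j) y) * waveDensity Φ Φ' 0 y ∂boxMeasure a b 0 = 0 := by simp
  rw [h0, add_zero]
  -- Vanishing almost everywhere on the larger box passes to almost every slice, so the inner series
  -- is finite before sum and integral are exchanged.
  have hae : ∀ᵐ x ∂volume.restrict (Set.Icc a b), ∀ N, n ≤ N → ∀ᵐ y ∂boxMeasure a b N,
      waveDensity Φ Φ' (N + 1) (Fin.cons x y) = 0 := by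
    refine ae_all_iff.2 fun N => ?_
    by_cases hN : n ≤ N
    · have h1 := (measurePreserving_cons a b N).quasiMeasurePreserving.ae
        (waveDensity_ae_zero (hn (N + 1) (by omega)) Φ')
      filter_upwards [Measure.ae_ae_of_ae_prod h1] with x hx _
      exact hx
    · exact Eventually.of_forall fun x h => (hN h).elim
  have hsum : ∀ᵐ x ∂volume.restrict (Set.Icc a b),
      ∑' N : ℕ, ∫ y, ((N + 1 : ℂ) * (w (N + 1) x (Fin.cons x y) *
        waveDensity Φ Φ' (N + 1) (Fin.cons x y))) ∂boxMeasure a b N =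
      ∑ N ∈ Finset.range n, ∫ y, ((N + 1 : ℂ) * (w (N + 1) x (Fin.cons x y) *
        waveDensity Φ Φ' (N + 1) (Fin.cons x y))) ∂boxMeasure a b N := by
    filter_upwards [hae] with x hx
    refine tsum_eq_sum fun N hN => ?_
    rw [integral_eq_zero_of_ae]
    filter_upwards [hx N (by simpa using hN)] with y hy
    rw [hy, mul_zero, mul_zero]
    rfl
  rw [integral_congr_ae hsum, integral_finsetSum]
  · refine Finset.sum_congr rfl fun N _ => ?_
    rw [hw.integral_sum, ← integral_const_mul, ← integral_integral_cons (hint N)]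
    rfl
  · intro N _
    exact (Integrable.comp_cons (hint N)).integral_prod_left

theorem isWeight_stringWeight (a b c : ℝ) :
    IsWeight a b fun _ z y => (stringWeight c z y : ℂ) where
  measurable _ := Complex.measurable_ofReal.comp (measurable_stringWeight c)
  bounded := ⟨|a - c| + |b - c|, fun N z hz y => by
    rw [Complex.norm_real]
    exact abs_stringWeight_le hz y⟩
  symm N z y σ := by rw [stringWeight_perm]

theorem conj_annihilate_mul (Φ Φ' : Fock a b) (N : ℕ) (x : ℝ) (y : Fin N → ℝ) :
    (starRingEnd ℂ) (annihilate x (wave Φ) N y) * annihilate x (wave Φ') N y =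
      (N + 1 : ℂ) * waveDensity Φ Φ' (N + 1) (Fin.cons x y) := by
  have hs : (Real.sqrt (N + 1) : ℂ) * (Real.sqrt (N + 1) : ℂ) = (N + 1 : ℂ) := by
    rw [← Complex.ofReal_mul, Real.mul_self_sqrt (by positivity)]
    push_cast
    rfl
  rw [annihilate, annihilate, waveDensity, ← hs, map_mul, Complex.conj_ofReal]
  ring

/-- The string acts before the annihilation, so its sign is evaluated at the full configuration
`Fin.cons x y`. The integrand is therefore `stringWeight` at the first coordinate, and
`IsWeight.integral_tsum` turns it into the sum over all particles. -/
theorem stringForm_eq_tsum (c : ℝ) {Φ : Fock a b} (hΦ : FiniteParticle Φ) (Φ' : Fock a b) :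
    stringForm a b c (wave Φ) (wave Φ') =
      ∑' N, ⟪Φ N, mulOp _ (isMultiplier_stringPhase a b c N) (Φ' N)⟫_ℂ := by
  simp only [inner_mulOp_eq, stringPhase, Complex.ofReal_sum]
  rw [← (isWeight_stringWeight a b c).integral_tsum hΦ Φ', stringForm]
  refine integral_congr_ae (Eventually.of_forall fun x => ?_)
  simp only [braket]
  rw [← tsum_mul_left]
  refine tsum_congr fun N => ?_
  rw [← integral_const_mul]
  refine integral_congr_ae (Eventually.of_forall fun y => ?_)
  have h1 : annihilate x (stringParity x (wave Φ)) N y =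
      ((-1 : ℝ) ^ rightCount x (Fin.cons x y : Fin (N + 1) → ℝ) : ℝ) *
        annihilate x (wave Φ) N y := by
    simp only [annihilate, stringParity]
    push_cast
    ring
  simp only [h1, stringWeight, map_mul, Complex.conj_ofReal]
  rw [mul_assoc ((_ : ℝ) : ℂ), conj_annihilate_mul]
  push_cast
  ring

theorem finiteParticle_single (N : ℕ) (v : sector a b N) :
    FiniteParticle (lp.single 2 N v : Fock a b) :=
  ⟨N + 1, fun M hM => lp.single_apply_ne _ _ _ (by omega)⟩

/-- Single-sector vectors have finitely many particles and already separate the components of `Ξ`,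
which matches the coordinatewise description of the graph. -/
theorem isStringOperator_lpDiagonal (a b c : ℝ) :
    IsStringOperator a b c
      (lpDiagonal fun N => mulOp _ (isMultiplier_stringPhase a b c N)) := by
  intro Φ Ξ
  rw [mem_graph_lpDiagonal]
  constructor
  · intro h Φ₀ hΦ₀
    rw [stringForm_eq_tsum c hΦ₀, lp.inner_eq_tsum]
    simp only [h]
  · intro h N
    refine ext_inner_left ℂ fun v => ?_
    have h1 := h _ (finiteParticle_single N v)
    rw [stringForm_eq_tsum c (finiteParticle_single N v), lp.inner_single_left,
      tsum_eq_single N fun M hM => by rw [lp.single_apply_ne _ _ _ hM, inner_zero_left],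
      lp.single_apply_self] at h1
    exact h1

/-- `Π(x) = ∫_x^b n(z) dz` in the sense of matrix elements. -/
theorem braket_stringNumber {x : ℝ} (hx : x ∈ Set.Icc a b) {Φ : Fock a b}
    (hΦ : FiniteParticle Φ) (Φ' : Fock a b) :
    braket a b (wave Φ) (stringNumber x (wave Φ')) =
      ∫ z in x..b, braket a b (annihilate z (wave Φ)) (annihilate z (wave Φ')) := by
  -- Summed over the particles, this indicator weight is `rightCount x`.
  have hw : IsWeight a b fun _ z _ => if x < z then (1 : ℂ) else 0 :=
    { measurable := fun N => Measurable.ite (measurableSet_lt measurable_const measurable_fst)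
        measurable_const measurable_const
      bounded := ⟨1, fun N z _ y => by split_ifs <;> simp⟩
      symm := fun _ _ _ _ => rfl }
  have h1 := hw.integral_tsum hΦ Φ'
  have h2 : braket a b (wave Φ) (stringNumber x (wave Φ')) = ∑' N, ∫ y : Fin N → ℝ,
      (∑ j, if x < y j then (1 : ℂ) else 0) * waveDensity Φ Φ' N y ∂boxMeasure a b N := by
    refine tsum_congr fun N => integral_congr_ae (Eventually.of_forall fun y => ?_)
    simp only [stringNumber, rightCount, Finset.card_filter, waveDensity]
    push_cast
    ring
  rw [h2, ← h1, intervalIntegral.integral_of_le hx.2]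
  have h3 : Set.Ioc x b = Set.Icc a b ∩ Set.Ioi x := by
    ext z
    simp only [Set.mem_Ioc, Set.mem_inter_iff, Set.mem_Icc, Set.mem_Ioi]
    exact ⟨fun h => ⟨⟨hx.1.trans h.1.le, h.2⟩, h.1⟩, fun h => ⟨h.2, h.1.2⟩⟩
  rw [h3, ← setIntegral_indicator measurableSet_Ioi]
  refine integral_congr_ae (Eventually.of_forall fun z => ?_)
  by_cases hz : x < z
  · rw [Set.indicator_of_mem (show z ∈ Set.Ioi x from hz)]
    simp only [if_pos hz, one_mul, braket, conj_annihilate_mul]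
  · rw [Set.indicator_of_notMem (show z ∉ Set.Ioi x from hz)]
    simp [if_neg hz]

end Sectors

/-! ### The matrix product coefficients -/

/-- The phase `e^{i ω s / 2}`. -/
def halfPhase (ω s : ℝ) : ℂ := Complex.exp (I * ((ω / 2 * s : ℝ) : ℂ))

theorem halfPhase_add (ω s t : ℝ) : halfPhase ω (s + t) = halfPhase ω s * halfPhase ω t := by
  rw [halfPhase, halfPhase, halfPhase, ← Complex.exp_add]
  push_cast
  ring_nf

theorem halfPhase_zero (ω : ℝ) : halfPhase ω 0 = 1 := by simp [halfPhase]

theorem propagator_zero (x y : ℝ) : propagator 0 x y = 1 := by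
  simp [propagator]

theorem propagator_bondQ (ω x y : ℝ) :
    propagator (bondQ ω) x y = Matrix.diagonal ![halfPhase ω (y - x), halfPhase ω (x - y)] := by
  have h : ((y - x : ℝ) : ℂ) • bondQ ω =
      Matrix.diagonal ![I * ((ω / 2 * (y - x) : ℝ) : ℂ), I * ((ω / 2 * (x - y) : ℝ) : ℂ)] := by
    ext i j
    fin_cases i <;> fin_cases j <;> simp [bondQ, pauliZ] <;> ring
  rw [propagator, h, Matrix.exp_diagonal]
  congr 1
  ext i
  rw [Pi.coe_exp]
  fin_cases i <;> simp [halfPhase, Complex.exp_eq_exp_ℂ]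

theorem propagator_mul (ω x y z : ℝ) :
    propagator (bondQ ω) x y * propagator (bondQ ω) y z = propagator (bondQ ω) x z := by
  rw [propagator_bondQ, propagator_bondQ, propagator_bondQ, Matrix.diagonal_mul_diagonal]
  congr 1
  ext i
  fin_cases i <;> simp [← halfPhase_add]

theorem propagator_self (ω x : ℝ) : propagator (bondQ ω) x x = 1 := by
  simp [propagator]

/-- The phase of an ordered list of positions, the last one counted with sign `-1`. -/
def listPhase : List ℝ → ℝ
  | [] => 0
  | x :: l => -(-1) ^ l.length * x + listPhase l

theorem phaseFunction_eq_listPhase {N : ℕ} (x : Fin N → ℝ) :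
    phaseFunction x = listPhase (List.ofFn x) := by
  induction N with
  | zero => simp [phaseFunction, listPhase]
  | succ N ih =>
    rw [List.ofFn_succ, listPhase, ← ih, phaseFunction, phaseFunction, Fin.sum_univ_succ,
      List.length_ofFn, neg_add]
    simp

/-- `V_p^{x₁} X V_{x₁}^{x₂} ⋯ X V_{x_N}^b V_b^c` is `V_p^c` times the product of the matrices
`V_c^{x_j} X V_{x_j}^c`. -/
theorem matrixChain_mul_propagator (ω b c : ℝ) (l : List ℝ) : ∀ p : ℝ,
    matrixChain (bondQ ω) (fun _ => pauliX) b p l * propagator (bondQ ω) b c =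
      propagator (bondQ ω) p c *
        matrixChain 0 (fun s => propagator (bondQ ω) c s * pauliX * propagator (bondQ ω) s c)
          b p l := by
  induction l with
  | nil =>
    intro p
    rw [matrixChain, matrixChain, propagator_mul, propagator_zero, mul_one]
  | cons x l ih =>
    intro p
    rw [matrixChain, matrixChain, mul_assoc, ih, propagator_zero, one_mul]
    simp only [← mul_assoc]
    rw [propagator_mul]

/-- `X` exchanges the eigenvectors of `Z`, so the half phases on its two sides add instead of
cancelling. -/
theorem propagator_mul_pauliX_mul (ω c s : ℝ) :
    propagator (bondQ ω) c s * pauliX * propagator (bondQ ω) s c =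
      !![0, halfPhase ω (2 * (s - c)); halfPhase ω (-(2 * (s - c))), 0] := by
  have h1 : 2 * (s - c) = (s - c) + (s - c) := by ring
  have h2 : -(2 * (s - c)) = (c - s) + (c - s) := by ring
  rw [propagator_bondQ, propagator_bondQ, h2, h1, halfPhase_add, halfPhase_add]
  ext i j
  fin_cases i <;> fin_cases j <;> simp [pauliX, Matrix.mul_apply, Fin.sum_univ_two]

theorem trace_ketZeroBraPlus_mul (M : Matrix (Fin 2) (Fin 2) ℂ) :
    (ketZeroBraPlus * M).trace = M 0 0 + M 1 0 := by
  simp [ketZeroBraPlus, Matrix.trace, Matrix.mul_apply, Fin.sum_univ_two]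

/-- A product of antidiagonal factors is diagonal or antidiagonal according to parity. Prepending a
factor flips the row of the nonzero entry and adds a phase whose sign depends on the parity of the
tail, as in `listPhase`. -/
theorem matrixChain_first_column (ω b c : ℝ) (l : List ℝ) : ∀ p : ℝ,
    let M := matrixChain 0
      (fun s => propagator (bondQ ω) c s * pauliX * propagator (bondQ ω) s c) b p l
    (Even l.length → M 0 0 = halfPhase ω (2 * listPhase (l.map (· - c))) ∧ M 1 0 = 0) ∧
      (Odd l.length → M 0 0 = 0 ∧ M 1 0 = halfPhase ω (2 * listPhase (l.map (· - c)))) := by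
  induction l with
  | nil => intro p; simp [matrixChain, propagator_zero, listPhase, halfPhase_zero]
  | cons x l ih =>
    intro p
    obtain ⟨he, ho⟩ := ih x
    simp only [matrixChain, propagator_zero, one_mul, propagator_mul_pauliX_mul] at he ho ⊢
    simp only [List.length_cons, Nat.even_add_one, Nat.odd_add_one, Nat.not_even_iff_odd,
      Nat.not_odd_iff_even, List.map_cons, listPhase, List.length_map]
    constructor
    · intro h
      obtain ⟨h0, h1⟩ := ho h
      simp [Matrix.mul_apply, Fin.sum_univ_two, h0, h1, h.neg_one_pow, ← halfPhase_add, mul_add]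
    · intro h
      obtain ⟨h0, h1⟩ := he h
      simp [Matrix.mul_apply, Fin.sum_univ_two, h0, h1, h.neg_one_pow, ← halfPhase_add, mul_add]
      congr 1
      ring

theorem trace_matrixChain (ω a b c : ℝ) {N : ℕ} (x : Fin N → ℝ) :
    (ketZeroBraPlus * matrixChain 0
      (fun s => propagator (bondQ ω) c s * pauliX * propagator (bondQ ω) s c) b a
      (List.ofFn x)).trace =
      Complex.exp (I * ((ω * phaseFunction (fun j => x j - c) : ℝ) : ℂ)) := by
  have h1 : Complex.exp (I * ((ω * phaseFunction (fun j => x j - c) : ℝ) : ℂ)) =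
      halfPhase ω (2 * listPhase ((List.ofFn x).map (· - c))) := by
    rw [phaseFunction_eq_listPhase, List.map_ofFn, halfPhase]
    congr 3
    simp only [Function.comp_def]
    ring
  obtain ⟨he, ho⟩ := matrixChain_first_column ω b c (List.ofFn x) a
  rw [trace_ketZeroBraPlus_mul, h1]
  rcases Nat.even_or_odd (List.ofFn x).length with h | h
  · rw [(he h).1, (he h).2, add_zero]
  · rw [(ho h).1, (ho h).2, zero_add]

/-- Cyclicity of the trace moves `V_b^c` to the right end of the chain. Pulling it through leaves
`V_a^c` on the left, which cancels against `V_c^a` from the boundary matrix. -/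
theorem mpCoeff_bulk (ω a b c : ℝ) {N : ℕ} (x : Fin N → ℝ) :
    mpCoeff a b (propagator (bondQ ω) b c * ketZeroBraPlus * propagator (bondQ ω) c a)
        (bondQ ω) (fun _ => pauliX) x =
      Complex.exp (I * ((ω * phaseFunction (fun j => x j - c) : ℝ) : ℂ)) := by
  rw [mpCoeff, mul_assoc, mul_assoc, Matrix.trace_mul_comm, mul_assoc, mul_assoc,
    matrixChain_mul_propagator, ← mul_assoc (propagator (bondQ ω) c a), propagator_mul,
    propagator_self, one_mul, trace_matrixChain]

theorem mpCoeff_bulk_left (ω a b : ℝ) {N : ℕ} (x : Fin N → ℝ) :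
    mpCoeff a b (propagator (bondQ ω) b a * ketZeroBraPlus) (bondQ ω) (fun _ => pauliX) x =
      Complex.exp (I * ((ω * phaseFunction (fun j => x j - a) : ℝ) : ℂ)) := by
  rw [← mpCoeff_bulk ω a b a x, propagator_self, mul_one]

theorem mpCoeff_constant_boundary (ω a b c : ℝ) {N : ℕ} (x : Fin N → ℝ) :
    mpCoeff a b ketZeroBraPlus 0
        (fun s => propagator (bondQ ω) c s * pauliX * propagator (bondQ ω) s c) x =
      Complex.exp (I * ((ω * phaseFunction (fun j => x j - c) : ℝ) : ℂ)) :=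
  trace_matrixChain ω a b c x

/-! ### The string exponential -/

theorem isStringExponential_of_mpCoeff {a b c ω : ℝ} {B Q : Matrix (Fin 2) (Fin 2) ℂ}
    {T : ℝ → Matrix (Fin 2) (Fin 2) ℂ}
    (h : ∀ (N : ℕ) (x : Fin N → ℝ), mpCoeff a b B Q T x =
      Complex.exp (I * ((ω * phaseFunction (fun j => x j - c) : ℝ) : ℂ))) :
    IsStringExponential a b c ω B Q T := by
  have hk := isMultiplier_stringPhase a b c
  let W : ∀ N, ℝ → sector a b N →L[ℂ] sector a b N := fun N t => mulOp _ ((hk N).phase t)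
  have hW : ∀ t N x, ‖W N t x‖ ≤ ‖x‖ := by
    intro t N x
    have := norm_mulOp_le ((hk N).phase t) (C := 1) (Filter.Eventually.of_forall fun y => by
      rw [← mul_neg, ← Complex.ofReal_neg, mul_comm, Complex.norm_exp_ofReal_mul_I]) x
    rwa [one_mul] at this
  have hgroup : IsUnitaryGroupOf (lpDiagonal fun N => mulOp _ (hk N))
      fun t => lpContraction (fun N => W N t) (hW t) := by
    refine isUnitaryGroupOf_lpDiagonal hW (fun N => mulOp_eq_one _ fun y => by simp)
      (fun N s t => mulOp_mul _ _ _ fun y => ?_) (fun N t => inner_mulOp_left _ _ fun y => ?_)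
      fun N => hasDerivAt_mulOp_phase (hk N)
    · rw [← Complex.exp_add]
      push_cast
      ring_nf
    · rw [← Complex.exp_conj]
      simp
  refine ⟨lpContraction (fun N => W N ω) (hW ω), lpDiagonal fun N => mulOp _ (hk N),
    isDiagonalCMPO_of_phase (fun N => (hk N).phase ω) (fun _ _ => rfl) fun N x hx => ?_,
    hgroup.unitary ω, isStringOperator_lpDiagonal a b c, isSelfAdjoint_lpDiagonal fun N =>
      inner_mulOp_left _ _ fun y => Complex.conj_ofReal _, _, hgroup, rfl⟩
  -- The minus sign in `k = -θ` cancels the one in `exp(-iωk)`.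
  rw [h, stringPhase_of_strictMono c hx]
  congr 1
  push_cast
  ring

end StringCMPU

end

theorem mainTheorem11 (ω a b : ℝ) (hω : 0 < ω) (hab : a < b) :
    -- bulk-uniform tensors with `B = V_b^a |0)(+|`, positions measured from the left end
    ((∀ (N : ℕ) (x : Fin N → ℝ),
        mpCoeff a b (propagator (bondQ ω) b a * ketZeroBraPlus) (bondQ ω) (fun _ => pauliX) x =
          Complex.exp (Complex.I * ((ω * phaseFunction (fun j => x j - a) : ℝ) : ℂ))) ∧
      IsStringExponential a b a ω
        (propagator (bondQ ω) b a * ketZeroBraPlus) (bondQ ω) (fun _ => pauliX)) ∧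
    -- bulk-uniform tensors with `B = V_b^0 |0)(+| V_0^a`
    ((∀ (N : ℕ) (x : Fin N → ℝ),
        mpCoeff a b (propagator (bondQ ω) b 0 * ketZeroBraPlus * propagator (bondQ ω) 0 a)
            (bondQ ω) (fun _ => pauliX) x =
          Complex.exp (Complex.I * ((ω * phaseFunction x : ℝ) : ℂ))) ∧
      IsStringExponential a b 0 ω
        (propagator (bondQ ω) b 0 * ketZeroBraPlus * propagator (bondQ ω) 0 a)
        (bondQ ω) (fun _ => pauliX)) ∧
    -- constant boundary `B = |0)(+|` with `Q = 0` and `T(x) = e^{i ω x Z / 2} X e^{-i ω x Z / 2}`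
    ((∀ (N : ℕ) (x : Fin N → ℝ),
        mpCoeff a b ketZeroBraPlus 0
            (fun s => propagator (bondQ ω) 0 s * pauliX * propagator (bondQ ω) s 0) x =
          Complex.exp (Complex.I * ((ω * phaseFunction x : ℝ) : ℂ))) ∧
      IsStringExponential a b 0 ω ketZeroBraPlus 0
        (fun s => propagator (bondQ ω) 0 s * pauliX * propagator (bondQ ω) s 0)) ∧
    -- `Π(x) = ∫_x^b n(z) dz` in the sense of matrix elements
    (∀ x ∈ Set.Icc a b, ∀ Φ Φ' : Fock a b, FiniteParticle Φ → FiniteParticle Φ' →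
      braket a b (wave Φ) (stringNumber x (wave Φ')) =
        ∫ z in x..b, braket a b (annihilate z (wave Φ)) (annihilate z (wave Φ'))) := by
  refine ⟨⟨fun N x => mpCoeff_bulk_left ω a b x,
      isStringExponential_of_mpCoeff fun N x => mpCoeff_bulk_left ω a b x⟩,
    ⟨fun N x => ?_, isStringExponential_of_mpCoeff fun N x => mpCoeff_bulk ω a b 0 x⟩,
    ⟨fun N x => ?_, isStringExponential_of_mpCoeff fun N x =>
      mpCoeff_constant_boundary ω a b 0 x⟩,
    fun x hx Φ Φ' hΦ _ => braket_stringNumber hx hΦ Φ'⟩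
  · simpa only [sub_zero] using mpCoeff_bulk ω a b 0 x
  · simpa only [sub_zero] using mpCoeff_constant_boundary ω a b 0 x
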